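/- A discrete single-input/single-output linear time-invariant (LTI) system with $n$ states, $x_{k+1}=\overline{A}x_k+\overline{B}u_k$, $y_k=\overline{C}x_k+\overline{D}u_k$, whose matrix $\overline{A}$ has all eigenvalues in the open unit disk, has the Hankel operator $\overline{H}:\ell^2\to\ell^2$ with matrix entries $\overline{H}_{i,j}=\overline{C}\,\overline{A}^{\,i+j}\overline{B}$, $i,j\ge 0$, and Hankel singular values $\sigma_1\ge\dots\ge\sigma_n\ge0$ (the $n$ largest singular values of $\overline{H}$, which has rank at most $n$). For $\epsilon>0$ its $\epsilon$-rank is $\operatorname{rank}_\epsilon=\max\{1\le j\le n:\sigma_j/\sigma_1>\epsilon\}$ ($0$ if there is no such $j$). Theorem. There is an absolute constant $C_0>0$, and for all $M,\rho_0>0$ there are $K>0$ and $N\in\mathbb{N}$ depending only on $M$ and $\rho_0$, such that the following holds. Let $0<\alpha\le 1$ and $0<\delta\le 1$. Then there are exponents $\beta=\beta_n$, which may depend on $n,\alpha,\delta,M,\rho_0$ but not on $\epsilon$ or on the random system, with $$\beta_n\le\frac{1}{1+\alpha}+\frac{\ln\bigl(2+\sqrt{\ln(1/\delta)/2}\bigr)}{\ln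 n}\qquad(n\ge 2),$$ such that, for every $\epsilon>0$: (a) $\ln(\delta^{-3/2}\epsilon^{-1}n)\,n^{\beta_n}=o(n)$ as $n\to\infty$. (b) Let $n\ge2$ and let $\overline{\Gamma}=(\overline{A},\overline{B},\overline{C},\overline{D})$ be a random system as above with $n$ states such that $\overline{A}=\operatorname{diag}(a_1,\dots,a_n)$, almost surely $|a_j|<1$ for all $j$, the $a_j$ are i.i.d. complex random variables with $$\mathbb{P}(|a_j|>1-\rho)\le M\rho^\alpha\qquad\text{for all }0<\rho<\rho_0,$$ and the entries $b_jc_j$ of $\overline{B}\circ\overline{C}^{\top}$ are i.i.d. real standard normal $\mathcal{N}(0,1)$. Then with probability at least $1-\delta$ $$\operatorname{rank}_\epsilon(\overline{\Gamma})\le K\,\bigl|\ln(\delta^{-3/2}\epsilon^{-1}n)\bigr|\,n^{\beta_n},$$ and, if $n\ge N$, with probability at least $1-\delta$ the same bound holds with $K$ replaced by the absolute constant $C_0$. No independence between $(a_j)$ and $(b_jc_j)$ is assumed. -/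

import Mathlib

open MeasureTheory ProbabilityTheory Filter
open scoped ENNReal lp ComplexConjugate

noncomputable section

/-- A discrete, single-input/single-output, linear time-invariant system with `n` states,
`x_{k+1} = A x_k + B u_k`, `y_k = C x_k + D u_k`. -/
structure DiscreteLTI (n : ℕ) where
  A : Matrix (Fin n) (Fin n) ℂ
  B : Fin n → ℂ
  C : Fin n → ℂ
  D : ℂ

/-- The Markov parameter `C A^k B`. -/
def DiscreteLTI.markov {n : ℕ} (Γ : DiscreteLTI n) (k : ℕ) : ℂ :=
  Γ.C ⬝ᵥ ((Γ.A ^ k).mulVec Γ.B)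

/-- `T` is the bounded operator on `ℓ²` with matrix entries `H i j = C A^(i+j) B`. -/
def DiscreteLTI.IsHankelOperator {n : ℕ} (Γ : DiscreteLTI n)
    (T : ℓ²(ℕ, ℂ) →L[ℂ] ℓ²(ℕ, ℂ)) : Prop :=
  ∀ i j : ℕ, (T (lp.single 2 j (1 : ℂ))) i = Γ.markov (i + j)

/-- A bounded operator on `ℓ²` is determined by its matrix. -/
theorem DiscreteLTI.IsHankelOperator.unique {n : ℕ} {Γ : DiscreteLTI n}
    {S T : ℓ²(ℕ, ℂ) →L[ℂ] ℓ²(ℕ, ℂ)} (hS : Γ.IsHankelOperator S) (hT : Γ.IsHankelOperator T) :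
    S = T := by
  ext x : 1
  have hx := lp.hasSum_single (p := 2) (by simp) x
  have h1 := hx.mapL S
  have h2 := hx.mapL T
  refine h1.unique ?_
  convert h2 using 2 with j
  have hs : lp.single (E := fun _ : ℕ => ℂ) 2 j (x j)
      = x j • lp.single (E := fun _ : ℕ => ℂ) 2 j (1 : ℂ) := by
    rw [← lp.single_smul]; simp
  rw [hs, map_smul, map_smul]
  congr 1
  ext i
  rw [hS i j, hT i j]

/-- The geometric sequence `(1, a, a², …)` is in `ℓ²` for `|a| < 1`. -/
theorem memlp_geometric {a : ℂ} (ha : ‖a‖ < 1) : Memℓp (fun i : ℕ => a ^ i) 2 := by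
  refine memℓp_gen ?_
  have h : Summable fun i : ℕ => (‖a‖ ^ 2) ^ i :=
    summable_geometric_of_lt_one (by positivity) (by nlinarith [norm_nonneg a])
  refine h.congr fun i => ?_
  simp only [norm_pow, ENNReal.toReal_ofNat, Real.rpow_ofNat]
  ring

/-- A system with diagonal state matrix and poles in the open unit disk has a bounded
Hankel operator. -/
theorem DiscreteLTI.exists_isHankelOperator {n : ℕ} (Γ : DiscreteLTI n) (a : Fin n → ℂ)
    (hA : Γ.A = Matrix.diagonal a) (ha : ∀ j, ‖a j‖ < 1) :
    ∃ T : ℓ²(ℕ, ℂ) →L[ℂ] ℓ²(ℕ, ℂ), Γ.IsHankelOperator T := by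
  have ha' : ∀ j, ‖conj (a j)‖ < 1 := fun j => by simpa using ha j
  let v : Fin n → ℓ²(ℕ, ℂ) := fun j => ⟨_, memlp_geometric (ha j)⟩
  let w : Fin n → ℓ²(ℕ, ℂ) := fun j => ⟨_, memlp_geometric (ha' j)⟩
  refine ⟨∑ j, (Γ.B j * Γ.C j) • (innerSL ℂ (w j)).smulRight (v j), fun i k => ?_⟩
  have hw : ∀ j, inner ℂ (w j) (lp.single 2 k (1 : ℂ)) = a j ^ k := fun j => by
    rw [lp.inner_single_right]
    simp [w]
  simp only [sum_apply, smul_apply,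
    ContinuousLinearMap.smulRight_apply, innerSL_apply_apply, hw, lp.coeFn_sum, Finset.sum_apply,
    lp.coeFn_smul, Pi.smul_apply, smul_eq_mul, DiscreteLTI.markov, hA, Matrix.diagonal_pow,
    Matrix.mulVec_diagonal, dotProduct, Pi.pow_apply, v]
  refine Finset.sum_congr rfl fun j _ => ?_
  rw [pow_add]; ring

open Classical in
/-- The Hankel operator of `Γ` on `ℓ²` (set to `0` if the Hankel matrix is not bounded on `ℓ²`,
which never happens for a diagonal system with all poles in the open unit disk). -/
def DiscreteLTI.hankelOperator {n : ℕ} (Γ : DiscreteLTI n) : ℓ²(ℕ, ℂ) →L[ℂ] ℓ²(ℕ, ℂ) :=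
  if h : ∃ T, Γ.IsHankelOperator T then h.choose else 0

theorem DiscreteLTI.isHankelOperator_hankelOperator {n : ℕ} (Γ : DiscreteLTI n) (a : Fin n → ℂ)
    (hA : Γ.A = Matrix.diagonal a) (ha : ∀ j, ‖a j‖ < 1) :
    Γ.IsHankelOperator Γ.hankelOperator := by
  have h := Γ.exists_isHankelOperator a hA ha
  rw [DiscreteLTI.hankelOperator, dif_pos h]
  exact h.choose_spec

/-- The `k`-th singular value (`k ≥ 1`, in decreasing order, with multiplicity) of a compact
operator `T` on a Hilbert space: the square root of the `k`-th largest eigenvalue of `T† T`.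
It is the largest `s ≥ 0` such that the eigenspaces of `T† T` for the eigenvalues `t ≥ s ^ 2`
have total dimension at least `k`. -/
def singularValue {E : Type*} [NormedAddCommGroup E] [InnerProductSpace ℂ E] [CompleteSpace E]
    (T : E →L[ℂ] E) (k : ℕ) : ℝ :=
  sSup {s : ℝ | 0 ≤ s ∧ (k : Cardinal) ≤ Module.rank ℂ
    ↥(⨆ t : {t : ℝ // s ^ 2 ≤ t},
      Module.End.eigenspace ((T.adjoint ∘L T : E →L[ℂ] E) : E →ₗ[ℂ] E) ((t : ℝ) : ℂ))}

/-- The Hankel singular values `σ_1 ≥ σ_2 ≥ ⋯ ≥ σ_n`. -/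
def DiscreteLTI.hankelSV {n : ℕ} (Γ : DiscreteLTI n) (k : ℕ) : ℝ :=
  singularValue Γ.hankelOperator k

/-- The `ε`-rank `max {j | σ_j / σ_1 > ε}`, with `j` ranging over `1, …, n` (and the maximum of
the empty set equal to `0`). -/
def DiscreteLTI.epsRank {n : ℕ} (ε : ℝ) (Γ : DiscreteLTI n) : ℕ :=
  ((Finset.Icc 1 n).filter fun j => ε < Γ.hankelSV j / Γ.hankelSV 1).sup id

end

/-! ### Singular values via eigenspaces of `T† T`. -/

section SingularValue

variable {E : Type*} [NormedAddCommGroup E] [InnerProductSpace ℂ E] [CompleteSpace E]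

/-! Fix a margin `ρ` and call a pole bad if it lies outside the disk of radius `1 - ρ`. Each bad
pole contributes a rank-one term to the Hankel operator; on sequences whose first `k` entries
vanish, the other terms have norm at most `(∑ |b_j c_j|) (1 - ρ)^k / ρ`. By the easy half of
Courant–Fischer this bounds every singular value of index above (number of bad poles) + `k`
(`hankelSV_le`). Since `σ₁ ≥ |H₀₀| = |∑ b_j c_j|` (`norm_sum_le_hankelSV_one`), the `ε`-rank is
controlled by three random quantities.

Each estimate fails with probability at most `δ/3`: Gaussian anti-concentration gives `|∑ b_j c_j| ≥
δ√n/3`, Markov gives `∑ |b_j c_j|² ≤ 3n/δ`, and Hoeffding bounds the bad poles by `n M ρ^α + √n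
√(ln(3/δ)/2)`. A union bound suffices, so poles and weights may be dependent. The choice `ρ =
n^(-1/(1+α))` balances `n ρ^α` against `1/ρ`, the scale of `k` up to logarithms. -/

theorem sq_mul_norm_sq_le_of_mem_iSup_eigenspace (T : E →L[ℂ] E) {s : ℝ} {x : E}
    (hx : x ∈ ⨆ t : {t : ℝ // s ^ 2 ≤ t},
      Module.End.eigenspace ((T.adjoint ∘L T : E →L[ℂ] E) : E →ₗ[ℂ] E) ((t : ℝ) : ℂ)) :
    s ^ 2 * ‖x‖ ^ 2 ≤ ‖T x‖ ^ 2 := by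
  set S : E →L[ℂ] E := T.adjoint ∘L T with hS
  have hsymm : (S : E →ₗ[ℂ] E).IsSymmetric := by
    intro u v
    simp [hS, ContinuousLinearMap.adjoint_inner_left, ContinuousLinearMap.adjoint_inner_right]
  -- Eigenspaces for distinct eigenvalues are orthogonal, so `‖x‖²` and `‖T x‖² = ⟪T† T x, x⟫` both
  -- split over the components, the latter with weights `t ≥ s²`.
  have hV := hsymm.orthogonalFamily_eigenspaces.comp
    (f := fun t : {t : ℝ // s ^ 2 ≤ t} => ((t : ℝ) : ℂ))
    (fun t u h => Subtype.ext (Complex.ofReal_injective h))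
  obtain ⟨f, hf, rfl⟩ := (Submodule.mem_iSup_iff_exists_finsupp _ _).1 hx
  let l : ∀ t : {t : ℝ // s ^ 2 ≤ t}, Module.End.eigenspace (S : E →ₗ[ℂ] E) ((t : ℝ) : ℂ) :=
    fun t => ⟨f t, hf t⟩
  have hnorm := hV.norm_sum l f.support
  have hSx : S (f.sum fun _ y => y) = ∑ t ∈ f.support, (((t : ℝ) : ℂ) • l t : E) := by
    rw [Finsupp.sum, map_sum]
    exact Finset.sum_congr rfl fun t _ => Module.End.mem_eigenspace_iff.1 (hf t)
  have hinner := hV.inner_sum (fun t => ((t : ℝ) : ℂ) • l t) l f.support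
  have hT : ‖T (f.sum fun _ y => y)‖ ^ 2 = ∑ t ∈ f.support, (t : ℝ) * ‖l t‖ ^ 2 := by
    have h1 : ((‖T (f.sum fun _ y => y)‖ ^ 2 : ℝ) : ℂ)
        = inner ℂ (S (f.sum fun _ y => y)) (f.sum fun _ y => y) := by
      rw [hS, ContinuousLinearMap.comp_apply, ContinuousLinearMap.adjoint_inner_left,
        inner_self_eq_norm_sq_to_K]
      simp
    have h2 : inner ℂ (S (f.sum fun _ y => y)) (f.sum fun _ y => y)
        = ∑ t ∈ f.support, inner ℂ (((t : ℝ) : ℂ) • l t) (l t) := by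
      rw [← hinner, hSx]; rfl
    rw [h2] at h1
    apply Complex.ofReal_injective
    rw [h1]
    push_cast
    refine Finset.sum_congr rfl fun t _ => ?_
    rw [inner_smul_left, inner_self_eq_norm_sq_to_K]
    simp
  have hx' : ‖f.sum fun _ y => y‖ ^ 2 = ∑ t ∈ f.support, ‖l t‖ ^ 2 := hnorm
  rw [hT, hx', Finset.mul_sum]
  exact Finset.sum_le_sum fun t _ => mul_le_mul_of_nonneg_right t.2 (by positivity)

/-- The easy half of the Courant–Fischer principle. -/
theorem le_of_natCast_le_rank_iSup_eigenspace (T : E →L[ℂ] E) {k : ℕ} {F : Type*}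
    [AddCommGroup F] [Module ℂ F] [FiniteDimensional ℂ F] (L : E →ₗ[ℂ] F)
    (hk : Module.finrank ℂ F < k) {c : ℝ}
    (hL : ∀ x, L x = 0 → ‖T x‖ ≤ c * ‖x‖) {s : ℝ}
    (hs : 0 ≤ s ∧ (k : Cardinal) ≤ Module.rank ℂ
      ↥(⨆ t : {t : ℝ // s ^ 2 ≤ t},
        Module.End.eigenspace ((T.adjoint ∘L T : E →L[ℂ] E) : E →ₗ[ℂ] E) ((t : ℝ) : ℂ))) :
    s ≤ c := by
  set V := ⨆ t : {t : ℝ // s ^ 2 ≤ t},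
    Module.End.eigenspace ((T.adjoint ∘L T : E →L[ℂ] E) : E →ₗ[ℂ] E) ((t : ℝ) : ℂ) with hV
  -- Dimension count: `V` has rank at least `k`, more than the target of `L`.
  have hinj : ¬ Function.Injective (L ∘ₗ V.subtype) := by
    intro h
    have h1 := LinearMap.lift_rank_le_of_injective _ h
    rw [← Module.finrank_eq_rank ℂ F, Cardinal.lift_natCast] at h1
    have h2 := (Cardinal.lift_le.2 hs.2).trans h1
    rw [Cardinal.lift_natCast, Nat.cast_le] at h2
    omega
  rw [← LinearMap.ker_eq_bot] at hinj
  obtain ⟨x, hx, hx0⟩ := Submodule.exists_mem_ne_zero_of_ne_bot hinj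
  have hpos : 0 < ‖(x : E)‖ := norm_pos_iff.2 fun h => hx0 (Subtype.ext h)
  have h1 := sq_mul_norm_sq_le_of_mem_iSup_eigenspace T x.2
  have h2 := hL x (LinearMap.mem_ker.1 hx)
  rw [← mul_pow] at h1
  have h3 := (pow_le_pow_iff_left₀ (mul_nonneg hs.1 hpos.le) (norm_nonneg _) two_ne_zero).1 h1
  exact le_of_mul_le_mul_right (h3.trans h2) hpos

theorem singularValue_le (T : E →L[ℂ] E) {k : ℕ} {F : Type*}
    [AddCommGroup F] [Module ℂ F] [FiniteDimensional ℂ F] (L : E →ₗ[ℂ] F)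
    (hk : Module.finrank ℂ F < k) {c : ℝ} (hc : 0 ≤ c)
    (hL : ∀ x, L x = 0 → ‖T x‖ ≤ c * ‖x‖) : singularValue T k ≤ c :=
  -- The set may be empty, where `sSup` is `0`; hence `hc`.
  Real.sSup_le (fun _ hs => le_of_natCast_le_rank_iSup_eigenspace T L hk hL hs) hc

theorem bddAbove_singularValue_set (T : E →L[ℂ] E) {k : ℕ} (hk : 0 < k) :
    BddAbove {s : ℝ | 0 ≤ s ∧ (k : Cardinal) ≤ Module.rank ℂ
      ↥(⨆ t : {t : ℝ // s ^ 2 ≤ t},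
        Module.End.eigenspace ((T.adjoint ∘L T : E →L[ℂ] E) : E →ₗ[ℂ] E) ((t : ℝ) : ℂ))} :=
  ⟨‖T‖, fun _ hs => le_of_natCast_le_rank_iSup_eigenspace T (0 : E →ₗ[ℂ] (Fin 0 → ℂ))
    (by simpa using hk) (fun x _ => T.le_opNorm x) hs⟩

theorem singularValue_nonneg (T : E →L[ℂ] E) (k : ℕ) : 0 ≤ singularValue T k :=
  Real.sSup_nonneg fun _ hs => hs.1

theorem singularValue_le_singularValue_one (T : E →L[ℂ] E) {k : ℕ} (hk : 1 ≤ k) :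
    singularValue T k ≤ singularValue T 1 := by
  refine Real.sSup_le (fun s hs => ?_) (singularValue_nonneg T 1)
  refine le_csSup (bddAbove_singularValue_set T one_pos) ⟨hs.1, le_trans ?_ hs.2⟩
  exact_mod_cast hk

/-- The positive operator `T† T` has its norm `‖T‖²` in its spectrum, and compactness makes this
nonzero spectral value an eigenvalue. -/
theorem norm_le_singularValue_one (T : E →L[ℂ] E) (hT : IsCompactOperator T) :
    ‖T‖ ≤ singularValue T 1 := by
  rcases eq_or_ne T 0 with rfl | h0
  · simpa using singularValue_nonneg _ _
  have : Nontrivial E := by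
    by_contra h
    rw [not_nontrivial_iff_subsingleton] at h
    exact h0 (ContinuousLinearMap.ext fun x => Subsingleton.elim _ _)
  set S : E →L[ℂ] E := T.adjoint ∘L T with hS
  have hnorm : ‖S‖ = ‖T‖ ^ 2 := by
    rw [hS, sq]; exact ContinuousLinearMap.norm_adjoint_comp_self T
  have hpos : 0 < ‖T‖ ^ 2 := by positivity
  have hSc : IsCompactOperator S := hT.clm_comp T.adjoint
  have hspec : ((‖T‖ ^ 2 : ℝ) : ℂ) ∈ spectrum ℂ S := by
    have h1 : 0 ≤ S := (ContinuousLinearMap.nonneg_iff_isPositive _).2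
      (ContinuousLinearMap.isPositive_adjoint_comp_self T)
    have h2 := CStarAlgebra.norm_mem_spectrum_of_nonneg h1
    rw [hnorm] at h2
    exact spectrum.algebraMap_mem ℂ h2
  have heig := (hSc.hasEigenvalue_iff_mem_spectrum
    (by exact_mod_cast hpos.ne')).2 hspec
  refine le_csSup (bddAbove_singularValue_set T one_pos) ⟨norm_nonneg T, ?_⟩
  rw [Nat.cast_one, Cardinal.one_le_iff_ne_zero, Ne, Submodule.rank_eq_zero]
  intro hbot
  rw [iSup_eq_bot] at hbot
  exact heig (hbot ⟨‖T‖ ^ 2, le_rfl⟩)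

end SingularValue

/-! ### Deterministic bounds for diagonal Hankel operators. -/

section Hankel

theorem hasSum_norm_sq_geometric_tail {a : ℂ} (ha : ‖a‖ < 1) (k : ℕ) :
    HasSum (fun i : ℕ => ‖if i < k then 0 else a ^ i‖ ^ 2) ((‖a‖ ^ k) ^ 2 / (1 - ‖a‖ ^ 2)) := by
  rw [← hasSum_nat_add_iff' k]
  have h0 : ∑ i ∈ Finset.range k, ‖if i < k then 0 else a ^ i‖ ^ 2 = 0 :=
    Finset.sum_eq_zero fun i hi => by simp [Finset.mem_range.1 hi]
  rw [h0, sub_zero, div_eq_mul_inv]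
  refine ((hasSum_geometric_of_lt_one (r := ‖a‖ ^ 2) (by positivity)
    (by nlinarith [norm_nonneg a])).mul_left ((‖a‖ ^ k) ^ 2)).congr_fun fun i => ?_
  rw [if_neg (by omega), norm_pow]
  ring

theorem lp_two_hasSum_norm_sq (f : ℓ²(ℕ, ℂ)) : HasSum (fun i => ‖f i‖ ^ 2) (‖f‖ ^ 2) := by
  have h := lp.hasSum_norm (p := 2) (by simp) f
  simpa using h

theorem memlp_geometric_tail {a : ℂ} (ha : ‖a‖ < 1) (k : ℕ) :
    Memℓp (fun i : ℕ => if i < k then 0 else a ^ i) 2 :=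
  memℓp_gen (by simpa using (hasSum_norm_sq_geometric_tail ha k).summable)

/-- Only the tail of the geometric vector from index `k` on meets `x`; apply Cauchy–Schwarz to that
tail. -/
theorem norm_inner_geometric_le {a : ℂ} (ha : ‖a‖ < 1) (k : ℕ) {x : ℓ²(ℕ, ℂ)}
    (hx : ∀ i < k, x i = 0) :
    ‖inner ℂ (⟨_, memlp_geometric ha⟩ : ℓ²(ℕ, ℂ)) x‖ ≤ ‖a‖ ^ k / √(1 - ‖a‖ ^ 2) * ‖x‖ := by
  let w : ℓ²(ℕ, ℂ) := ⟨_, memlp_geometric_tail ha k⟩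
  have h1 : inner ℂ (⟨_, memlp_geometric ha⟩ : ℓ²(ℕ, ℂ)) x = inner ℂ w x := by
    rw [lp.inner_eq_tsum, lp.inner_eq_tsum]
    refine tsum_congr fun i => ?_
    by_cases hi : i < k
    · simp [hx i hi]
    · simp [w, hi]
  have h2 : ‖w‖ = ‖a‖ ^ k / √(1 - ‖a‖ ^ 2) := by
    have h3 : ‖w‖ ^ 2 = (‖a‖ ^ k) ^ 2 / (1 - ‖a‖ ^ 2) :=
      (lp_two_hasSum_norm_sq w).unique (hasSum_norm_sq_geometric_tail ha k)
    rw [← Real.sqrt_sq (norm_nonneg w), h3, Real.sqrt_div (by positivity),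
      Real.sqrt_sq (by positivity)]
  rw [h1, ← h2]
  exact norm_inner_le_norm _ _

theorem norm_geometric {a : ℂ} (ha : ‖a‖ < 1) :
    ‖(⟨_, memlp_geometric ha⟩ : ℓ²(ℕ, ℂ))‖ = 1 / √(1 - ‖a‖ ^ 2) := by
  have h : ‖(⟨_, memlp_geometric ha⟩ : ℓ²(ℕ, ℂ))‖ ^ 2 = 1 / (1 - ‖a‖ ^ 2) := by
    refine (lp_two_hasSum_norm_sq _).unique ?_
    simpa using hasSum_norm_sq_geometric_tail ha 0
  rw [← Real.sqrt_sq (norm_nonneg (⟨_, memlp_geometric ha⟩ : ℓ²(ℕ, ℂ))), h,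
    Real.sqrt_div zero_le_one, Real.sqrt_one]

namespace DiscreteLTI

variable {n : ℕ} (Γ : DiscreteLTI n) (a : Fin n → ℂ)

theorem norm_conj_lt_one {a : Fin n → ℂ} (ha : ∀ j, ‖a j‖ < 1) (j : Fin n) :
    ‖conj (a j)‖ < 1 := by simpa using ha j

/-- Since `a^(i+k) = a^i a^k`, each pole gives a rank-one term; the conjugate offsets the antilinear
first slot of the inner product. -/
theorem hankelOperator_eq_sum (hA : Γ.A = Matrix.diagonal a) (ha : ∀ j, ‖a j‖ < 1) :
    Γ.hankelOperator = ∑ j, (Γ.B j * Γ.C j) •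
      (innerSL ℂ (⟨_, memlp_geometric (norm_conj_lt_one ha j)⟩ : ℓ²(ℕ, ℂ))).smulRight
        (⟨_, memlp_geometric (ha j)⟩ : ℓ²(ℕ, ℂ)) := by
  refine (Γ.isHankelOperator_hankelOperator a hA ha).unique fun i k => ?_
  have hw : ∀ j, inner ℂ (⟨_, memlp_geometric (norm_conj_lt_one ha j)⟩ : ℓ²(ℕ, ℂ))
      (lp.single 2 k (1 : ℂ)) = a j ^ k := fun j => by
    rw [lp.inner_single_right]
    simp
  simp only [sum_apply, smul_apply, ContinuousLinearMap.smulRight_apply, innerSL_apply_apply, hw,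
    lp.coeFn_sum, Finset.sum_apply, lp.coeFn_smul, Pi.smul_apply, smul_eq_mul, DiscreteLTI.markov,
    hA, Matrix.diagonal_pow, Matrix.mulVec_diagonal, dotProduct, Pi.pow_apply]
  refine Finset.sum_congr rfl fun j _ => ?_
  rw [pow_add]; ring

theorem isCompactOperator_hankelOperator (hA : Γ.A = Matrix.diagonal a) (ha : ∀ j, ‖a j‖ < 1) :
    IsCompactOperator Γ.hankelOperator := by
  rw [Γ.hankelOperator_eq_sum a hA ha]
  refine Submodule.sum_mem (compactOperator (RingHom.id ℂ) ℓ²(ℕ, ℂ) ℓ²(ℕ, ℂ)) fun j _ => ?_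
  refine Submodule.smul_mem _ _ ?_
  exact ((isCompactOperator_id (E := ℂ)).comp_clm
    (innerSL ℂ (⟨_, memlp_geometric (norm_conj_lt_one ha j)⟩ : ℓ²(ℕ, ℂ)))).clm_comp
    (ContinuousLinearMap.toSpanSingleton ℂ (⟨_, memlp_geometric (ha j)⟩ : ℓ²(ℕ, ℂ)))

theorem norm_sum_le_hankelSV_one (hA : Γ.A = Matrix.diagonal a) (ha : ∀ j, ‖a j‖ < 1) :
    ‖∑ j, Γ.B j * Γ.C j‖ ≤ Γ.hankelSV 1 := by
  refine le_trans ?_ (norm_le_singularValue_one _ (Γ.isCompactOperator_hankelOperator a hA ha))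
  have h := Γ.isHankelOperator_hankelOperator a hA ha 0 0
  have h1 : Γ.markov (0 + 0) = ∑ j, Γ.B j * Γ.C j := by
    simp [markov, dotProduct, mul_comm]
  rw [← h1, ← h]
  refine (lp.norm_apply_le_norm (by simp) _ 0).trans ?_
  refine (Γ.hankelOperator.le_opNorm _).trans ?_
  rw [lp.norm_single (by simp)]
  simp

/-- Poles in the disk of radius `1 - ρ` contribute exponentially decaying singular values; each of
the other poles costs one singular value. -/
theorem hankelSV_le (hA : Γ.A = Matrix.diagonal a) (ha : ∀ j, ‖a j‖ < 1) {ρ : ℝ} (hρ : 0 < ρ)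
    (hρ1 : ρ ≤ 1) (k : ℕ) {m : ℕ} (hm : (Finset.univ.filter fun j => 1 - ρ < ‖a j‖).card + k < m) :
    Γ.hankelSV m ≤ (∑ j, ‖Γ.B j * Γ.C j‖) * ((1 - ρ) ^ k / ρ) := by
  let w : Fin n → ℓ²(ℕ, ℂ) := fun j => ⟨_, memlp_geometric (norm_conj_lt_one ha j)⟩
  -- The kernel of `L₁` annihilates the terms of the bad poles; that of `L₂` consists of sequences
  -- starting at index `k`.
  let L₁ : ℓ²(ℕ, ℂ) →ₗ[ℂ] ({j // 1 - ρ < ‖a j‖} → ℂ) :=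
    LinearMap.pi fun j => (innerSL ℂ (w j) : ℓ²(ℕ, ℂ) →ₗ[ℂ] ℂ)
  let L₂ : ℓ²(ℕ, ℂ) →ₗ[ℂ] (Fin k → ℂ) :=
    { toFun := fun x i => x i
      map_add' := fun x y => by ext i; simp
      map_smul' := fun c x => by ext i; simp }
  have hρ' : 0 ≤ 1 - ρ := by linarith
  refine singularValue_le _ (L₁.prod L₂) ?_ (by positivity) fun x hx => ?_
  · rw [Module.finrank_prod, Module.finrank_fintype_fun_eq_card,
      Module.finrank_fintype_fun_eq_card, Fintype.card_fin, Fintype.card_subtype]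
    exact hm
  have hx1 : ∀ j, 1 - ρ < ‖a j‖ → inner ℂ (w j) x = 0 := fun j hj =>
    congrFun (congrArg Prod.fst hx) ⟨j, hj⟩
  have hx2 : ∀ i < k, x i = 0 := fun i hi => congrFun (congrArg Prod.snd hx) ⟨i, hi⟩
  rw [Γ.hankelOperator_eq_sum a hA ha, sum_apply]
  refine (norm_sum_le _ _).trans ?_
  rw [Finset.sum_mul, Finset.sum_mul]
  refine Finset.sum_le_sum fun j _ => ?_
  rw [smul_apply, ContinuousLinearMap.smulRight_apply, innerSL_apply_apply, norm_smul, mul_assoc]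
  refine mul_le_mul_of_nonneg_left ?_ (norm_nonneg _)
  change ‖inner ℂ (w j) x • _‖ ≤ _
  by_cases hj : 1 - ρ < ‖a j‖
  · rw [hx1 j hj, zero_smul, norm_zero]
    positivity
  have h1 := norm_inner_geometric_le (norm_conj_lt_one ha j) k hx2
  rw [RCLike.norm_conj] at h1
  have hsq : 0 < 1 - ‖a j‖ ^ 2 := by nlinarith [ha j, norm_nonneg (a j)]
  rw [norm_smul, norm_geometric (ha j)]
  calc ‖inner ℂ (w j) x‖ * (1 / √(1 - ‖a j‖ ^ 2))
      ≤ ‖a j‖ ^ k / √(1 - ‖a j‖ ^ 2) * ‖x‖ * (1 / √(1 - ‖a j‖ ^ 2)) := by gcongr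
    _ = ‖a j‖ ^ k / (1 - ‖a j‖ ^ 2) * ‖x‖ := by
      rw [← Real.mul_self_sqrt hsq.le]; field_simp; rw [Real.sqrt_sq (Real.sqrt_nonneg _)]
    _ ≤ (1 - ρ) ^ k / ρ * ‖x‖ := by
      have h3 : ‖a j‖ ≤ 1 - ρ := not_lt.1 hj
      have h4 : ρ ≤ 1 - ‖a j‖ ^ 2 := by nlinarith [norm_nonneg (a j)]
      gcongr

theorem epsRank_le {ε : ℝ} {m : ℕ} (h : ∀ j, m < j → Γ.hankelSV j / Γ.hankelSV 1 ≤ ε) :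
    Γ.epsRank ε ≤ m := by
  refine Finset.sup_le fun j hj => ?_
  rw [id]
  by_contra hlt
  exact (Finset.mem_filter.1 hj).2.not_ge (h j (not_le.1 hlt))

theorem epsRank_eq_zero {ε : ℝ} (hε : 1 ≤ ε) : Γ.epsRank ε = 0 :=
  Nat.le_zero.1 <| Γ.epsRank_le fun _ hj =>
    (div_le_one_of_le₀ (singularValue_le_singularValue_one _ hj) (singularValue_nonneg _ 1)).trans hε

theorem epsRank_le_card (ε : ℝ) : Γ.epsRank ε ≤ n :=
  Finset.sup_le fun _ hj => (Finset.mem_Icc.1 (Finset.mem_filter.1 hj).1).2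

theorem epsRank_le_card_add (hA : Γ.A = Matrix.diagonal a) (ha : ∀ j, ‖a j‖ < 1) {ρ ε : ℝ}
    (hρ : 0 < ρ) (hρ1 : ρ ≤ 1) (k : ℕ) (h0 : 0 < ‖∑ j, Γ.B j * Γ.C j‖)
    (hk : (∑ j, ‖Γ.B j * Γ.C j‖) * ((1 - ρ) ^ k / ρ) ≤ ε * ‖∑ j, Γ.B j * Γ.C j‖) :
    Γ.epsRank ε ≤ (Finset.univ.filter fun j => 1 - ρ < ‖a j‖).card + k := by
  have h1 := Γ.norm_sum_le_hankelSV_one a hA ha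
  have hε : 0 ≤ ε := by
    by_contra hneg
    have : 0 ≤ (∑ j, ‖Γ.B j * Γ.C j‖) * ((1 - ρ) ^ k / ρ) := by
      have : 0 ≤ 1 - ρ := by linarith
      positivity
    nlinarith
  refine Γ.epsRank_le fun j hj => ?_
  rw [div_le_iff₀ (h0.trans_le h1)]
  exact (Γ.hankelSV_le a hA ha hρ hρ1 k hj).trans (hk.trans (by gcongr))

end DiscreteLTI

end Hankel

/-! ### Gaussian small-ball, second-moment and Hoeffding estimates. -/

section Probability

variable {Ω : Type*} [MeasurableSpace Ω] {P : Measure Ω} {ι : Type*}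

theorem hasLaw_sum_gaussianReal [IsProbabilityMeasure P] {G : ι → Ω → ℝ} (hind : iIndepFun G P)
    (hG : ∀ j, HasLaw (G j) (gaussianReal 0 1) P) (s : Finset ι) :
    HasLaw (∑ j ∈ s, G j) (gaussianReal 0 s.card) P := by
  classical
  induction s using Finset.induction_on with
  | empty =>
    refine ⟨by fun_prop, ?_⟩
    simp [Pi.zero_def, Measure.map_const]
  | insert i s hi ih =>
    have hi' : IndepFun (G i) (∑ j ∈ s, G j) P :=
      (hind.indepFun_finsetSum_of_notMem₀ (fun j => (hG j).aemeasurable) hi).symm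
    refine ⟨Finset.aemeasurable_sum _ fun j _ => (hG j).aemeasurable, ?_⟩
    rw [Finset.sum_insert hi, gaussianReal_add_gaussianReal_of_indepFun hi' (hG i).map_eq ih.map_eq,
      Finset.card_insert_of_notMem hi, zero_add]
    push_cast
    rw [add_comm]

/-- The density is at most `1/√(2πv) ≤ 1/(2√v)`, and the interval has length `2t`. -/
theorem gaussianReal_abs_lt_le {v : NNReal} (hv : v ≠ 0) (t : ℝ) :
    gaussianReal 0 v {x | |x| < t} ≤ ENNReal.ofReal (t / √v) := by
  rcases le_total t 0 with ht | ht
  · have : {x : ℝ | |x| < t} = ∅ :=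
      Set.eq_empty_of_forall_notMem fun x hx => (hx.trans_le ht).not_ge (abs_nonneg x)
    simp [this]
  have hv' : 0 < (v : ℝ) := by positivity
  have hset : {x : ℝ | |x| < t} = Set.Ioo (-t) t := by ext x; simp [abs_lt]
  rw [gaussianReal_apply 0 hv, hset]
  have hpdf : ∀ x, gaussianPDF 0 v x ≤ ENNReal.ofReal (1 / (2 * √v)) := fun x => by
    rw [gaussianPDF]
    refine ENNReal.ofReal_le_ofReal ?_
    rw [gaussianPDFReal, ← one_div]
    refine mul_le_of_le_one_right (by positivity) (Real.exp_le_one_iff.2 ?_) |>.trans ?_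
    · rw [neg_div]
      exact neg_nonpos.2 (by positivity)
    · gcongr
      refine Real.le_sqrt_of_sq_le ?_
      rw [mul_pow, Real.sq_sqrt hv'.le]
      nlinarith [Real.pi_gt_three]
  calc ∫⁻ x in Set.Ioo (-t) t, gaussianPDF 0 v x
      ≤ ∫⁻ _ in Set.Ioo (-t) t, ENNReal.ofReal (1 / (2 * √v)) := lintegral_mono hpdf
    _ = ENNReal.ofReal (t / √v) := by
      rw [setLIntegral_const, Real.volume_Ioo, ← ENNReal.ofReal_mul (by positivity)]
      congr 1
      field_simp
      ring

theorem hasLaw_re_of_hasLaw_map_ofReal {X : Ω → ℂ} {μ : Measure ℝ}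
    (hX : HasLaw X (μ.map (fun x : ℝ => (x : ℂ))) P) : HasLaw (fun ω => (X ω).re) μ P := by
  refine HasLaw.fun_comp (Y := Complex.re) ⟨Complex.measurable_re.aemeasurable, ?_⟩ hX
  rw [Measure.map_map Complex.measurable_re Complex.measurable_ofReal]
  exact Measure.map_id

variable [Fintype ι]

theorem measure_norm_sum_lt_le [IsProbabilityMeasure P] [Nonempty ι] {g : ι → Ω → ℂ}
    (hind : iIndepFun g P)
    (hg : ∀ j, HasLaw (g j) ((gaussianReal 0 1).map (fun x : ℝ => (x : ℂ))) P) (t : ℝ) :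
    P {ω | ‖∑ j, g j ω‖ < t} ≤ ENNReal.ofReal (t / √(Fintype.card ι)) := by
  have hG := hasLaw_sum_gaussianReal
    (hind.comp (fun _ => Complex.re) fun _ => Complex.measurable_re)
    (fun j => hasLaw_re_of_hasLaw_map_ofReal (hg j)) Finset.univ
  have hm := hG.measure_eq (p := fun x => |x| < t) (measurableSet_lt measurable_norm measurable_const)
  have hb := gaussianReal_abs_lt_le (v := (Finset.univ : Finset ι).card) (by simp) t
  rw [← hm] at hb
  refine (measure_mono fun ω hω => ?_).trans (hb.trans (by simp))
  rw [Set.mem_ofPred_eq] at hω ⊢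
  refine lt_of_le_of_lt ?_ hω
  rw [Finset.sum_apply]
  simp only [Function.comp_apply]
  rw [← Complex.re_sum]
  exact Complex.abs_re_le_norm _

/-- Markov's inequality with unit second moments. -/
theorem measure_le_sum_norm_sq_le {g : ι → Ω → ℂ}
    (hg : ∀ j, HasLaw (g j) ((gaussianReal 0 1).map (fun x : ℝ => (x : ℂ))) P)
    {c : ℝ} (hc : 0 < c) :
    P {ω | c ≤ ∑ j, ‖g j ω‖ ^ 2} ≤ ENNReal.ofReal (Fintype.card ι / c) := by
  have h1 : ∀ j, ∫⁻ ω, ENNReal.ofReal (‖g j ω‖ ^ 2) ∂P = 1 := fun j => by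
    rw [(hg j).lintegral_comp (f := fun z => ENNReal.ofReal (‖z‖ ^ 2)) (by fun_prop),
      lintegral_map (by fun_prop) Complex.measurable_ofReal]
    have h2 : ∫ x, x ^ 2 ∂(gaussianReal 0 1) = 1 := by
      have h3 := variance_fun_id_gaussianReal (μ := 0) (v := 1)
      rw [variance_of_integral_eq_zero (by fun_prop) (by simp)] at h3
      simpa using h3
    have h4 : Integrable (fun x : ℝ => x ^ 2) (gaussianReal 0 1) :=
      (memLp_id_gaussianReal 2).integrable_sq
    rw [← ENNReal.ofReal_one, ← h2, ofReal_integral_eq_lintegral_ofReal h4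
      (Eventually.of_forall fun x => sq_nonneg x)]
    simp
  have hae : ∀ j ∈ (Finset.univ : Finset ι),
      AEMeasurable (fun ω => ENNReal.ofReal (‖g j ω‖ ^ 2)) P := fun j _ => by
    have := (hg j).aemeasurable
    fun_prop
  have h5 := meas_ge_le_lintegral_div (μ := P) (ε := ENNReal.ofReal c)
    (Finset.aemeasurable_fun_sum _ hae) (by simpa using hc) ENNReal.ofReal_ne_top
  rw [lintegral_finsetSum' _ hae, Finset.sum_congr rfl fun j _ => h1 j] at h5
  rw [ENNReal.ofReal_div_of_pos hc, ENNReal.ofReal_natCast]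
  refine (measure_mono fun ω hω => ?_).trans (h5.trans (by simp))
  rw [Set.mem_ofPred_eq, ← ENNReal.ofReal_sum_of_nonneg fun _ _ => by positivity]
  exact ENNReal.ofReal_le_ofReal hω

open Classical in
/-- Hoeffding's inequality for the number of points of an independent sample that fall into `S`. -/
theorem measure_card_filter_mem_ge_le [IsProbabilityMeasure P] {𝓧 : Type*} [MeasurableSpace 𝓧]
    {a : ι → Ω → 𝓧} (hind : iIndepFun a P) (ha : ∀ j, AEMeasurable (a j) P) {S : Set 𝓧}
    (hS : MeasurableSet S) {p : ℝ} (hp0 : 0 ≤ p)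
    (hp : ∀ j, P {ω | a j ω ∈ S} ≤ ENNReal.ofReal p) {t : ℝ} (ht : 0 ≤ t) :
    P {ω | Fintype.card ι * p + t ≤ ((Finset.univ.filter fun j => a j ω ∈ S).card : ℝ)}
      ≤ ENNReal.ofReal (Real.exp (-(2 * t ^ 2) / Fintype.card ι)) := by
  let f : 𝓧 → ℝ := S.indicator 1
  have hf : Measurable f := measurable_one.indicator hS
  let m : ι → ℝ := fun j => ∫ ω, f (a j ω) ∂P
  -- Hoeffding's lemma: a centred variable with range in an interval of length `1` has sub-Gaussian
  -- parameter `1/4`.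
  have hsub : ∀ j ∈ (Finset.univ : Finset ι),
      HasSubgaussianMGF (fun ω => f (a j ω) - m j) ((‖(1 : ℝ) - 0‖₊ / 2) ^ 2) P := fun j _ =>
    hasSubgaussianMGF_of_mem_Icc (hf.comp_aemeasurable (ha j)) (Eventually.of_forall fun ω => by
      by_cases h : a j ω ∈ S <;> simp [f, h])
  have h := HasSubgaussianMGF.measure_sum_ge_le_of_iIndepFun
    (hind.comp (fun j x => f x - m j) fun j => hf.sub_const _) hsub ht
  have hm : ∀ j, m j ≤ p := fun j => by
    have h1 : m j = (P.map (a j)).real S := by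
      rw [← integral_indicator_one hS]
      exact (integral_map (ha j) hf.aestronglyMeasurable).symm
    rw [h1, map_measureReal_apply_of_aemeasurable (ha j) hS]
    exact ENNReal.toReal_le_of_le_ofReal hp0 (hp j)
  rw [← ofReal_measureReal]
  refine ENNReal.ofReal_le_ofReal ((measureReal_mono fun ω hω => ?_).trans (h.trans_eq ?_))
  · have h2 : ((Finset.univ.filter fun j => a j ω ∈ S).card : ℝ) = ∑ j, f (a j ω) := by
      simp [f, Set.indicator_apply, Finset.sum_boole]
    have h3 : ∑ j, m j ≤ Fintype.card ι * p := by
      simpa using Finset.sum_le_sum fun j (_ : j ∈ Finset.univ) => hm j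
    have h4 : Fintype.card ι * p + t ≤ ∑ j, f (a j ω) := h2 ▸ hω
    simp only [Set.mem_ofPred_eq, Function.comp_apply, Finset.sum_sub_distrib]
    linarith
  · congr 1
    simp
    ring

end Probability

/-! ### Elementary inequalities and bookkeeping of constants. -/

section Bounds

/-- Splitting of the logarithm that governs the bound. -/
theorem log_delta_eps_nat {δ ε : ℝ} (hδ : 0 < δ) (hε : 0 < ε) {n : ℕ} (hn : 2 ≤ n) :
    Real.log (δ ^ (-(3 / 2) : ℝ) * ε⁻¹ * n)
      = 3 / 2 * Real.log (1 / δ) + Real.log (1 / ε) + Real.log n := by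
  have hn' : (0 : ℝ) < n := by positivity
  rw [Real.log_mul (by positivity) hn'.ne', Real.log_mul (by positivity) (by positivity),
    Real.log_rpow hδ, one_div, one_div, Real.log_inv, Real.log_inv]
  ring

theorem log_nat_le_log_delta_eps_nat {δ ε : ℝ} (hδ : 0 < δ) (hδ1 : δ ≤ 1) (hε : 0 < ε)
    (hε1 : ε ≤ 1) {n : ℕ} (hn : 2 ≤ n) :
    Real.log n ≤ Real.log (δ ^ (-(3 / 2) : ℝ) * ε⁻¹ * n) := by
  rw [log_delta_eps_nat hδ hε hn]
  have h1 : 0 ≤ Real.log (1 / δ) := Real.log_nonneg ((one_le_div hδ).2 hδ1)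
  have h2 : 0 ≤ Real.log (1 / ε) := Real.log_nonneg ((one_le_div hε).2 hε1)
  linarith

theorem one_half_le_log_nat {n : ℕ} (hn : 2 ≤ n) : 1 / 2 ≤ Real.log n := by
  have h : Real.log 2 ≤ Real.log n := Real.log_le_log (by norm_num) (by exact_mod_cast hn)
  linarith [Real.log_two_gt_d9]

/-- This hides the factor `2 + √(ln(1/δ)/2)` in the exponent `β_n`. -/
theorem rpow_add_log_div_log {n : ℕ} (hn : 2 ≤ n) (x : ℝ) {c : ℝ} (hc : 0 < c) :
    (n : ℝ) ^ (x + Real.log c / Real.log n) = (n : ℝ) ^ x * c := by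
  have hn' : (0 : ℝ) < n := by positivity
  rw [Real.rpow_add hn', Real.rpow_def_of_pos hn' (_ / _),
    mul_div_cancel₀ _ (by linarith [one_half_le_log_nat hn]), Real.exp_log hc]

theorem isLittleO_log_mul_rpow {x : ℝ} (hx : x < 1) {c : ℝ} (hc : 0 < c) (C : ℝ) :
    (fun n : ℕ => Real.log (c * n) * ((n : ℝ) ^ x * C)) =o[atTop] (fun n : ℕ => (n : ℝ)) := by
  have hy : 0 < 1 - x := by linarith
  have h1 : (fun t : ℝ => Real.log c + Real.log t) =o[atTop] fun t : ℝ => t ^ (1 - x) :=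
    (Asymptotics.isLittleO_const_left.2 <| Or.inr <|
      tendsto_norm_atTop_atTop.comp (tendsto_rpow_atTop hy)).add (isLittleO_log_rpow_atTop hy)
  have h2 : (fun t : ℝ => t ^ x * C) =O[atTop] fun t : ℝ => t ^ x :=
    by simpa [mul_comm] using Asymptotics.isBigO_const_mul_self C (fun t : ℝ => t ^ x) atTop
  refine ((h1.mul_isBigO h2).comp_tendsto tendsto_natCast_atTop_atTop).congr' ?_ ?_
  · filter_upwards [eventually_gt_atTop 0] with n hn
    have hn' : (n : ℝ) ≠ 0 := by positivity
    simp [Real.log_mul hc.ne' hn']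
  · filter_upwards [eventually_gt_atTop 0] with n hn
    have hn' : (0 : ℝ) < n := by positivity
    simp [← Real.rpow_add hn']

theorem sqrt_log_three_div_le {δ : ℝ} (hδ : 0 < δ) (hδ1 : δ ≤ 1) :
    √(Real.log (3 / δ) / 2) ≤ 1 + √(Real.log (1 / δ) / 2) := by
  have h1 : 0 ≤ Real.log (1 / δ) := Real.log_nonneg ((one_le_div hδ).2 hδ1)
  have h3 : Real.log 3 ≤ 2 := by
    have := Real.log_le_sub_one_of_pos (show (0 : ℝ) < 3 by norm_num)
    linarith
  refine Real.sqrt_le_iff.2 ⟨by positivity, ?_⟩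
  have h2 := Real.sq_sqrt (show 0 ≤ Real.log (1 / δ) / 2 by positivity)
  have h4 : Real.log (3 / δ) = Real.log 3 + Real.log (1 / δ) := by
    rw [← Real.log_mul (by norm_num) (by positivity)]; ring_nf
  nlinarith [Real.sqrt_nonneg (Real.log (1 / δ) / 2)]

/-- Here `α ≤ 1` enters: the Hoeffding deviation of order `√n` is absorbed by the main term. -/
theorem sqrt_le_rpow_one_div_one_add {α : ℝ} (hα : 0 < α) (hα1 : α ≤ 1) {n : ℕ} (hn : 1 ≤ n) :
    √(n : ℝ) ≤ (n : ℝ) ^ (1 / (1 + α)) := by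
  rw [Real.sqrt_eq_rpow]
  refine Real.rpow_le_rpow_of_exponent_le (by exact_mod_cast hn) ?_
  gcongr
  linarith

theorem rpow_one_div_one_add_le {α : ℝ} (hα : 0 < α) {n : ℕ} (hn : 1 ≤ n) :
    (n : ℝ) ^ (1 / (1 + α)) ≤ n := by
  conv_rhs => rw [← Real.rpow_one (n : ℝ)]
  refine Real.rpow_le_rpow_of_exponent_le (by exact_mod_cast hn) ?_
  rw [div_le_one (by linarith)]
  linarith

/-- The balance `n ρ^α = 1/ρ` that determines the exponent. -/
theorem mul_inv_rpow_one_div_one_add {α : ℝ} (hα : 0 < α) {n : ℕ} (hn : 1 ≤ n) :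
    (n : ℝ) * (((n : ℝ) ^ (1 / (1 + α)))⁻¹) ^ α = (n : ℝ) ^ (1 / (1 + α)) := by
  have hn' : (0 : ℝ) < n := by positivity
  rw [← Real.rpow_neg hn'.le, ← Real.rpow_mul hn'.le]
  nth_rewrite 1 [← Real.rpow_one (n : ℝ)]
  rw [← Real.rpow_add hn']
  congr 1
  field_simp
  ring

theorem log_threshold_le {δ ε X : ℝ} (hδ : 0 < δ) (hδ1 : δ ≤ 1) (hε : 0 < ε) (hε1 : ε ≤ 1) {n : ℕ}
    (hn : 2 ≤ n) (hX : 0 < X) (hXn : X ≤ n) :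
    Real.log (6 * √n * δ ^ (-(3 / 2) : ℝ) * X * ε⁻¹)
      ≤ 5 * Real.log (δ ^ (-(3 / 2) : ℝ) * ε⁻¹ * n) := by
  have hn' : (0 : ℝ) < n := by positivity
  have h0 := log_nat_le_log_delta_eps_nat hδ hδ1 hε hε1 hn
  have h1 : Real.log X ≤ Real.log n := Real.log_le_log hX hXn
  -- From `6 ≤ 2³ ≤ n³`; with `√n` and `X` the coefficient of `ln n` is at most `3 + 1/2 + 1 ≤ 5`.
  have h2 : Real.log 6 ≤ 3 * Real.log n := by
    have h3 : Real.log 6 ≤ Real.log (2 ^ 3) := Real.log_le_log (by norm_num) (by norm_num)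
    rw [Real.log_pow] at h3
    have h4 : Real.log 2 ≤ Real.log n := Real.log_le_log (by norm_num) (by exact_mod_cast hn)
    push_cast at h3
    linarith
  rw [log_delta_eps_nat hδ hε hn] at h0 ⊢
  rw [Real.log_mul (by positivity) (by positivity), Real.log_mul (by positivity) hX.ne',
    Real.log_mul (by positivity) (by positivity), Real.log_mul (by norm_num) (by positivity),
    Real.log_sqrt hn'.le, Real.log_rpow hδ]
  rw [one_div, one_div, Real.log_inv, Real.log_inv] at h0 ⊢
  linarith [one_half_le_log_nat hn]

theorem one_sub_inv_pow_le_exp_neg {X l : ℝ} (hX : 1 ≤ X) {k : ℕ} (hk : X * l ≤ k) :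
    (1 - X⁻¹) ^ k ≤ Real.exp (-l) := by
  have hX0 : 0 < X := by linarith
  have h1 : 0 ≤ 1 - X⁻¹ := sub_nonneg.2 (inv_le_one_of_one_le₀ hX)
  calc (1 - X⁻¹) ^ k ≤ Real.exp (-X⁻¹) ^ k := by
        gcongr
        linarith [Real.add_one_le_exp (-X⁻¹)]
    _ = Real.exp (k * -X⁻¹) := (Real.exp_nat_mul _ _).symm
    _ ≤ Real.exp (-l) := by
      refine Real.exp_le_exp.2 ?_
      have : l ≤ X⁻¹ * k := by rwa [le_inv_mul_iff₀ hX0]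
      linarith

theorem sum_norm_le_of_sum_norm_sq_le {ι : Type*} [Fintype ι] {g : ι → ℂ} {c : ℝ}
    (h : ∑ j, ‖g j‖ ^ 2 ≤ c) : ∑ j, ‖g j‖ ≤ √(Fintype.card ι * c) := by
  refine Real.le_sqrt_of_sq_le ?_
  refine (sq_sum_le_card_mul_sum_sq (s := Finset.univ) (f := fun j => ‖g j‖)).trans ?_
  rw [Finset.card_univ]
  gcongr

/-- As `√3 ≤ 2`, `q ≤ 2n δ^(-1/2)`; dividing by `δ√n/3` produces the factor `6√n δ^(-3/2)` in the
threshold. -/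
theorem tail_le_of_small_ball {δ ε X q z e : ℝ} (hδ : 0 < δ) (hε : 0 < ε)
    (hX : 0 < X) {n : ℕ} (hn : 2 ≤ n) (hz : δ * √n / 3 ≤ z) (hq : q ≤ √(n * (3 * n / δ)))
    (he0 : 0 ≤ e) (he : e ≤ (6 * √n * δ ^ (-(3 / 2) : ℝ) * X * ε⁻¹)⁻¹) :
    q * (e / X⁻¹) ≤ ε * z := by
  have hn' : (0 : ℝ) < n := by positivity
  obtain ⟨u, hu, rfl⟩ : ∃ u : ℝ, 0 < u ∧ δ = u ^ 2 :=
    ⟨√δ, Real.sqrt_pos.2 hδ, (Real.sq_sqrt hδ.le).symm⟩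
  obtain ⟨v, hv, hnv⟩ : ∃ v : ℝ, 0 < v ∧ (n : ℝ) = v ^ 2 :=
    ⟨√n, Real.sqrt_pos.2 hn', (Real.sq_sqrt hn'.le).symm⟩
  have hD : (u ^ 2) ^ (-(3 / 2) : ℝ) = (u ^ 3)⁻¹ := by
    rw [← Real.rpow_natCast u 2, ← Real.rpow_mul hu.le, ← Real.rpow_natCast u 3,
      ← Real.rpow_neg hu.le]
    norm_num
  have hq' : q ≤ 2 * v ^ 2 / u := by
    refine hq.trans (Real.sqrt_le_iff.2 ⟨by positivity, ?_⟩)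
    rw [hnv, div_pow, ← mul_div_assoc]
    gcongr
    nlinarith [pow_pos hv 4]
  rw [hnv, Real.sqrt_sq hv.le] at hz he
  rw [hD] at he
  calc q * (e / X⁻¹) ≤ 2 * v ^ 2 / u * ((6 * v * (u ^ 3)⁻¹ * X * ε⁻¹)⁻¹ / X⁻¹) := by gcongr
    _ = ε * (u ^ 2 * v / 3) := by field_simp; norm_num
    _ ≤ ε * z := by gcongr

end Bounds

/-! ### The rank bound on the good event, and the main theorem. -/

theorem DiscreteLTI.epsRank_le_mul_log_mul_rpow {n : ℕ} (Γ : DiscreteLTI n) (a : Fin n → ℂ)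
    (hA : Γ.A = Matrix.diagonal a) (ha : ∀ j, ‖a j‖ < 1) (hn : 2 ≤ n) {α δ ε M : ℝ}
    (hα : 0 < α) (hα1 : α ≤ 1) (hδ : 0 < δ) (hδ1 : δ ≤ 1) (hε : 0 < ε) (hε1 : ε ≤ 1)
    (hM : M ≤ Real.log n)
    (hlow : δ * √n / 3 ≤ ‖∑ j, Γ.B j * Γ.C j‖)
    (hup : ∑ j, ‖Γ.B j * Γ.C j‖ ^ 2 ≤ 3 * n / δ)
    (hcard : ((Finset.univ.filter fun j => 1 - ((n : ℝ) ^ (1 / (1 + α)))⁻¹ < ‖a j‖).card : ℝ)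
      ≤ n * (M * ((n : ℝ) ^ (1 / (1 + α)))⁻¹ ^ α) + √n * √(Real.log (3 / δ) / 2)) :
    (Γ.epsRank ε : ℝ) ≤ 5 * (Real.log (δ ^ (-(3 / 2) : ℝ) * ε⁻¹ * n)
      * ((n : ℝ) ^ (1 / (1 + α)) * (2 + √(Real.log (1 / δ) / 2)))) := by
  have hn' : (0 : ℝ) < n := by positivity
  have hn1 : 1 ≤ n := by omega
  have hXn := rpow_one_div_one_add_le hα hn1
  have hXs := sqrt_le_rpow_one_div_one_add hα hα1 hn1
  have hXM := mul_inv_rpow_one_div_one_add hα hn1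
  have hX1 : 1 ≤ (n : ℝ) ^ (1 / (1 + α)) :=
    Real.one_le_rpow (by exact_mod_cast hn1) (by positivity)
  set X := (n : ℝ) ^ (1 / (1 + α))
  have hX0 : 0 < X := by linarith
  have hl := log_threshold_le hδ hδ1 hε hε1 hn hX0 hXn
  have hL := log_nat_le_log_delta_eps_nat hδ hδ1 hε hε1 hn
  have hL2 := one_half_le_log_nat hn
  set L := Real.log (δ ^ (-(3 / 2) : ℝ) * ε⁻¹ * n)
  have ht := sqrt_log_three_div_le hδ hδ1
  set s := √(Real.log (1 / δ) / 2)
  have hs : 0 ≤ s := Real.sqrt_nonneg _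
  set y := 6 * √n * δ ^ (-(3 / 2) : ℝ) * X * ε⁻¹
  have hy0 : 0 < y := by positivity
  have hk := one_sub_inv_pow_le_exp_neg hX1 (Nat.le_ceil (X * Real.log y))
  rw [Real.exp_neg, Real.exp_log hy0] at hk
  have hq := sum_norm_le_of_sum_norm_sq_le hup
  rw [Fintype.card_fin] at hq
  have hρ1 : X⁻¹ ≤ 1 := inv_le_one_of_one_le₀ hX1
  have hrank := Γ.epsRank_le_card_add a hA ha (inv_pos.2 hX0) hρ1 ⌈X * Real.log y⌉₊
    (lt_of_lt_of_le (by positivity) hlow)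
    (tail_le_of_small_ball hδ hε hX0 hn hlow hq (pow_nonneg (sub_nonneg.2 hρ1) _) hk)
  have hrank' : (Γ.epsRank ε : ℝ) ≤
      ((Finset.univ.filter fun j => 1 - X⁻¹ < ‖a j‖).card : ℝ) + ⌈X * Real.log y⌉₊ := by
    exact_mod_cast hrank
  have hceil : (⌈X * Real.log y⌉₊ : ℝ) ≤ X * (5 * L) + 1 := by
    have h1 : (⌈X * Real.log y⌉₊ : ℝ) ≤ ⌈X * (5 * L)⌉₊ := by
      exact_mod_cast Nat.ceil_mono (by gcongr)
    have h2 := Nat.ceil_lt_add_one (show 0 ≤ X * (5 * L) by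
      have : 0 ≤ L := by linarith
      positivity)
    linarith
  have hcard' : n * (M * X⁻¹ ^ α) + √n * √(Real.log (3 / δ) / 2) ≤ L * X + X * (1 + s) := by
    have h1 : n * (M * X⁻¹ ^ α) = M * X := by linear_combination M * hXM
    rw [h1]
    gcongr
    linarith
  -- The total is at most `6LX + X(1+s) + 1`. As `X ≥ 1` and `L ≥ 1/2`, the last two terms are at
  -- most `X(2+s) ≤ 2LX(2+s)`; the target exceeds the result by `3LXs`.
  have h3 : 0 ≤ (L - 1 / 2) * (X * (2 + s)) := mul_nonneg (by linarith) (by positivity)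
  have h4 : 0 ≤ L * X * s := by
    have : 0 ≤ L := by linarith
    positivity
  nlinarith

theorem mainTheorem1 :
    -- `C₀` is an absolute constant
    ∃ C₀ : ℝ, 0 < C₀ ∧
      -- `M` and `ρ₀` quantify the hypothesis `ℙ(|a_j| > 1 - ρ) = O(ρ ^ α)` as `ρ → 0⁺`
      ∀ M ρ₀ : ℝ, 0 < M → 0 < ρ₀ →
      ∃ K : ℝ, 0 < K ∧ ∃ N : ℕ,
      ∀ α δ : ℝ, 0 < α → α ≤ 1 → 0 < δ → δ ≤ 1 →
      ∃ β : ℕ → ℝ,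
        (∀ n : ℕ, 2 ≤ n →
          β n ≤ 1 / (1 + α) + Real.log (2 + √(Real.log (1 / δ) / 2)) / Real.log n) ∧
        -- the bound is sublinear in `n`
        (∀ ε : ℝ, 0 < ε →
          (fun n : ℕ => Real.log (δ ^ (-(3 / 2) : ℝ) * ε⁻¹ * n) * (n : ℝ) ^ β n)
            =o[atTop] (fun n : ℕ => (n : ℝ))) ∧
        ∀ n : ℕ, 2 ≤ n → ∀ ε : ℝ, 0 < ε →
        ∀ (Ω : Type*) [MeasurableSpace Ω] (P : Measure Ω) [IsProbabilityMeasure P]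
          (a : Fin n → Ω → ℂ) (Γ : Ω → DiscreteLTI n),
          -- the state matrix is diagonal with entries `a_j` in the open unit disk
          (∀ ω, (Γ ω).A = Matrix.diagonal fun j => a j ω) →
          (∀ᵐ ω ∂P, ∀ j, ‖a j ω‖ < 1) →
          -- the `a_j` are i.i.d. with the tail condition
          (∀ j, AEMeasurable (a j) P) →
          iIndepFun a P →
          (∀ i j, IdentDistrib (a i) (a j) P P) →
          (∀ j, ∀ ρ : ℝ, 0 < ρ → ρ < ρ₀ →
            P {ω | 1 - ρ < ‖a j ω‖} ≤ ENNReal.ofReal (M * ρ ^ α)) →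
          -- the entries `b_j c_j` of `B ∘ Cᵀ` are i.i.d. real standard normal
          (∀ j, HasLaw (fun ω => (Γ ω).B j * (Γ ω).C j)
            ((gaussianReal 0 1).map (fun x : ℝ => (x : ℂ))) P) →
          iIndepFun (fun j ω => (Γ ω).B j * (Γ ω).C j) P →
          -- the bound fails with probability at most `δ`
          P {ω | ¬ ((Γ ω).epsRank ε : ℝ) ≤
              K * (|Real.log (δ ^ (-(3 / 2) : ℝ) * ε⁻¹ * n)| * (n : ℝ) ^ β n)}
            ≤ ENNReal.ofReal δ ∧
          (N ≤ n →
            P {ω | ¬ ((Γ ω).epsRank ε : ℝ) ≤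
                C₀ * (|Real.log (δ ^ (-(3 / 2) : ℝ) * ε⁻¹ * n)| * (n : ℝ) ^ β n)}
              ≤ ENNReal.ofReal δ) := by
  refine ⟨5, by norm_num, fun M ρ₀ hM hρ₀ => ?_⟩
  -- For `n ≥ N`, `M ≤ ln n` and `n^(-1/(1+α)) ≤ n^(-1/2) < ρ₀`, uniformly in `α` and `δ`.
  set N : ℕ := max ⌈Real.exp M⌉₊ (⌈1 / ρ₀ ^ 2⌉₊ + 1)
  refine ⟨5 + 2 * N, by positivity, N, fun α δ hα hα1 hδ hδ1 => ?_⟩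
  have hs : 0 < 2 + √(Real.log (1 / δ) / 2) := by positivity
  refine ⟨fun n => 1 / (1 + α) + Real.log (2 + √(Real.log (1 / δ) / 2)) / Real.log n,
    fun n _ => le_rfl, fun ε hε => ?_, ?_⟩
  · refine (isLittleO_log_mul_rpow (x := 1 / (1 + α)) ((div_lt_one (by linarith)).2 (by linarith))
      (c := δ ^ (-(3 / 2) : ℝ) * ε⁻¹) (by positivity)
      (2 + √(Real.log (1 / δ) / 2))).congr' ?_ EventuallyEq.rfl
    filter_upwards [eventually_ge_atTop 2] with n hn
    rw [rpow_add_log_div_log hn _ hs]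
  intro n hn ε hε Ω _ P _ a Γ hA ha ham hai _ htail hg hgi
  have hn' : (0 : ℝ) < n := by positivity
  have hn1 : 1 ≤ n := by omega
  have : Nonempty (Fin n) := ⟨⟨0, by omega⟩⟩
  rw [rpow_add_log_div_log hn _ hs]
  set L := Real.log (δ ^ (-(3 / 2) : ℝ) * ε⁻¹ * n)
  have hX1 : 1 ≤ (n : ℝ) ^ (1 / (1 + α)) :=
    Real.one_le_rpow (by exact_mod_cast hn1) (by positivity)
  have hXs := sqrt_le_rpow_one_div_one_add hα hα1 hn1
  -- For `ε ≥ 1` the rank is `0`, as `σ_j ≤ σ₁`.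
  rcases le_total 1 ε with hε1 | hε1
  · have h0 : ∀ c : ℝ, 0 ≤ c → P {ω | ¬ ((Γ ω).epsRank ε : ℝ) ≤
        c * (|L| * ((n : ℝ) ^ (1 / (1 + α)) * (2 + √(Real.log (1 / δ) / 2))))}
          ≤ ENNReal.ofReal δ := fun c hc => by
      have : {ω | ¬ ((Γ ω).epsRank ε : ℝ) ≤
        c * (|L| * ((n : ℝ) ^ (1 / (1 + α)) * (2 + √(Real.log (1 / δ) / 2))))} = ∅ := by
        refine Set.eq_empty_of_forall_notMem fun ω hω => hω ?_
        rw [(Γ ω).epsRank_eq_zero hε1, Nat.cast_zero]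
        positivity
      rw [this, measure_empty]
      exact zero_le
    exact ⟨h0 _ (by positivity), fun _ => h0 _ (by norm_num)⟩
  have hL0 : 1 / 2 ≤ L :=
    (one_half_le_log_nat hn).trans (log_nat_le_log_delta_eps_nat hδ hδ1 hε hε1 hn)
  have hLabs : |L| = L := abs_of_nonneg (by linarith)
  have key : N ≤ n → P {ω | ¬ ((Γ ω).epsRank ε : ℝ) ≤
      5 * (|L| * ((n : ℝ) ^ (1 / (1 + α)) * (2 + √(Real.log (1 / δ) / 2))))}
        ≤ ENNReal.ofReal δ := fun hNn => by
    have hMn : M ≤ Real.log n := by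
      rw [Real.le_log_iff_exp_le hn']
      exact (Nat.le_ceil _).trans (by exact_mod_cast (le_max_left _ _).trans hNn)
    have hρ : ((n : ℝ) ^ (1 / (1 + α)))⁻¹ < ρ₀ := by
      have h1 : 1 / ρ₀ ^ 2 < n := (Nat.le_ceil _).trans_lt
        (by exact_mod_cast (Nat.lt_succ_self _).trans_le ((le_max_right _ _).trans hNn))
      have h2 : 1 / ρ₀ < √n := Real.lt_sqrt_of_sq_lt (by rwa [div_pow, one_pow])
      rw [inv_lt_comm₀ (by linarith) hρ₀, ← one_div]
      exact h2.trans_le hXs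
    have hlog3 : 0 ≤ Real.log (3 / δ) :=
      Real.log_nonneg ((one_le_div hδ).2 (by linarith))
    have h1 := measure_norm_sum_lt_le hgi hg (δ * √n / 3)
    have h2 := measure_le_sum_norm_sq_le hg (show 0 < 3 * n / δ by positivity)
    have h3 := measure_card_filter_mem_ge_le hai ham
      (S := {z | 1 - ((n : ℝ) ^ (1 / (1 + α)))⁻¹ < ‖z‖})
      (measurableSet_lt measurable_const measurable_norm)
      (p := M * ((n : ℝ) ^ (1 / (1 + α)))⁻¹ ^ α) (by positivity)
      (fun j => htail j _ (by positivity) hρ)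
      (t := √n * √(Real.log (3 / δ) / 2)) (by positivity)
    rw [Fintype.card_fin] at h1 h2 h3
    have e1 : δ * √n / 3 / √n = δ / 3 := by field_simp
    have e2 : n / (3 * n / δ) = δ / 3 := by field_simp
    have e3 : Real.exp (-(2 * (√n * √(Real.log (3 / δ) / 2)) ^ 2) / n) = δ / 3 := by
      rw [mul_pow, Real.sq_sqrt hn'.le, Real.sq_sqrt (by positivity)]
      have : -(2 * (n * (Real.log (3 / δ) / 2))) / n = Real.log (δ / 3) := by
        rw [← inv_div 3 δ, Real.log_inv]; field_simp
      rw [this, Real.exp_log (by positivity)]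
    rw [e1] at h1
    rw [e2] at h2
    rw [e3] at h3
    -- The `0` is for the null event that some pole leaves the open disk.
    have hδ3 : ENNReal.ofReal δ = 0 + ENNReal.ofReal (δ / 3) + ENNReal.ofReal (δ / 3)
        + ENNReal.ofReal (δ / 3) := by
      rw [zero_add, ← ENNReal.ofReal_add (by positivity) (by positivity),
        ← ENNReal.ofReal_add (by positivity) (by positivity)]
      congr 1
      ring
    rw [hδ3]
    refine le_trans (measure_mono ?_) <| (measure_union_le _ _).trans <| add_le_add
      ((measure_union_le _ _).trans <| add_le_add
        ((measure_union_le _ _).trans <| add_le_add (ae_iff.1 ha).le h1) h2) h3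
    intro ω hω
    by_contra hnot
    simp only [Set.mem_union, Set.mem_ofPred_eq, not_or, not_not, not_lt, not_le] at hnot hω
    obtain ⟨⟨⟨g0, g1⟩, g2⟩, g3⟩ := hnot
    rw [hLabs] at hω
    refine hω.not_ge ?_
    refine (Γ ω).epsRank_le_mul_log_mul_rpow (fun j => a j ω) (hA ω) g0 hn hα hα1 hδ hδ1 hε hε1
      hMn g1 g2.le ?_
    convert g3.le
  refine ⟨?_, key⟩
  rcases le_or_gt N n with hNn | hNn
  · refine (measure_mono ?_).trans (key hNn)
    intro ω hω
    rw [Set.mem_ofPred_eq] at hω ⊢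
    refine fun h => hω (h.trans ?_)
    gcongr
    linarith [show (0 : ℝ) ≤ N from Nat.cast_nonneg N]
  -- For `n < N` the trivial bound `n` on the rank suffices: the factor multiplying `K = 5 + 2N` is
  -- at least `(1/2) · 1 · 2 = 1`.
  · refine (measure_mono_null ?_ measure_empty).le.trans zero_le
    intro ω hω
    rw [Set.mem_ofPred_eq] at hω
    refine hω ?_
    refine (show ((Γ ω).epsRank ε : ℝ) ≤ N by
      exact_mod_cast ((Γ ω).epsRank_le_card ε).trans hNn.le).trans ?_
    rw [hLabs]
    have h2 : 2 ≤ 2 + √(Real.log (1 / δ) / 2) := by linarith [Real.sqrt_nonneg (Real.log (1 / δ) / 2)]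
    have h3 : (1 : ℝ) / 2 * (1 * 2) ≤
        L * ((n : ℝ) ^ (1 / (1 + α)) * (2 + √(Real.log (1 / δ) / 2))) := by gcongr
    nlinarith [show (0 : ℝ) ≤ N from Nat.cast_nonneg N]
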